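/- Let $k$ and $m$ be relatively prime positive integers. For every divisor $d$ of $m$ let $$\Phi(d)=\{\beta\in\mathbb F_{2^d} : X^{2^k+1}+X+\beta \text{ has no root in } \mathbb F_{2^d}\},$$ and let $N(d)$ be the number of $\beta\in\Phi(d)$ that do not lie in any subfield $\mathbb F_{2^{d'}}$ of $\mathbb F_{2^d}$ with $d'\mid d$ and $d'<d$. Let $$B(m)=\bigl\{\{\beta^{2^i} : i\in\{0,\dots,m-1\}\} : \beta\in\Phi(m)\bigr\}$$ be the set of orbits of the elements of $\Phi(m)$ under the Galois group $\mathrm{Gal}(\mathbb F_{2^m}/\mathbb F_2)$, and let $b(m)=|B(m)|$. Then $$b(m)=\sum_{m'\mid m,\ 3\nmid \frac{m}{m'}}\frac{N(m')}{m'}.$$ Moreover, the numbers $N(m')$, for $m'\mid m$, are given explicitly as follows. Let $P$ be the set of prime divisors of $m'$ different from $3$. If $P=\emptyset$, that is, if $m'$ is a power of $3$ (including $m'=1$), then $N(m')=\frac{2^{m'}+1}{3}$. If $P\neq\emptyset$, then $$N(m')=\frac13\Bigl(\sum_{S\subseteq P}(-1)^{|S|}\,2^{\,m'/\prod_{p\in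 S}p}-\varepsilon\Bigr),$$ where $\varepsilon=2$ if $|P|=1$ and $m'\equiv 2\pmod 4$, and $\varepsilon=0$ otherwise. -/

import Mathlib

open Polynomial

/-- The set of all `β` in the field with `2 ^ m` elements such that `X ^ (2 ^ k + 1) + X + β`
has no root in that field. -/
def Phi (k m : ℕ) : Set (GaloisField 2 m) :=
  {β | ∀ x : GaloisField 2 m, ¬ (X ^ (2 ^ k + 1) + X + C β : (GaloisField 2 m)[X]).IsRoot x}

/-- The number of `β ∈ Phi k m` that lie in no subfield with `2 ^ m'` elements, where `m'` runs
through the proper divisors of `m`. -/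
noncomputable def numN (k m : ℕ) : ℕ :=
  {β ∈ Phi k m | ∀ m' : ℕ, m' ∣ m → m' < m →
    ∀ K : Subfield (GaloisField 2 m), Nat.card K = 2 ^ m' → β ∉ K}.ncard

/-- The set of conjugates `β ^ (2 ^ i)`, `0 ≤ i < m`, of an element `β` of the field with `2 ^ m`
elements. -/
def galOrbit {m : ℕ} (β : GaloisField 2 m) : Set (GaloisField 2 m) :=
  {γ | ∃ i : ℕ, i < m ∧ γ = β ^ (2 ^ i)}

/-- `galOrbit β` is the orbit of `β` under the Galois group over the prime field. -/
theorem galOrbit_eq_orbit {m : ℕ} (hm : m ≠ 0) (β : GaloisField 2 m) :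
    galOrbit β = MulAction.orbit (GaloisField 2 m ≃ₐ[ZMod 2] GaloisField 2 m) β := by
  have hfin := GaloisField.finrank 2 hm
  have hpow : ∀ (i : ℕ) (x : GaloisField 2 m),
      ((FiniteField.frobeniusAlgEquivOfAlgebraic (ZMod 2) (GaloisField 2 m)) ^ i) x
        = x ^ (2 ^ i) := by
    intro i
    induction i with
    | zero => intro x; simp
    | succ n ih =>
      intro x
      rw [pow_succ, AlgEquiv.mul_apply, ih]
      simp only [FiniteField.coe_frobeniusAlgEquivOfAlgebraic, ZMod.card]
      rw [← pow_mul, pow_succ, mul_comm]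
  ext γ
  constructor
  · rintro ⟨i, -, rfl⟩
    exact ⟨(FiniteField.frobeniusAlgEquivOfAlgebraic (ZMod 2) (GaloisField 2 m)) ^ i, hpow i β⟩
  · rintro ⟨g, rfl⟩
    obtain ⟨i, rfl⟩ := (FiniteField.bijective_frobeniusAlgEquivOfAlgebraic_pow
      (ZMod 2) (GaloisField 2 m)).2 g
    exact ⟨i, lt_of_lt_of_eq i.2 hfin, hpow i β⟩

/-- The set of Galois orbits of the elements of `Phi k m`. -/
def orbitSet (k m : ℕ) : Set (Set (GaloisField 2 m)) :=
  {O | ∃ β ∈ Phi k m, O = galOrbit β}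

/-- The number of Galois orbits of the elements of `Phi k m`. -/
noncomputable def numB (k m : ℕ) : ℕ := (orbitSet k m).ncard

/-- The prime divisors of `m` different from `3`. -/
def primesNotThree (m : ℕ) : Finset ℕ := m.primeFactors.erase 3

/-- The explicit value of `numN k m`: it is `(2 ^ m + 1) / 3` if `m` is a power of `3`, and
otherwise one third of the alternating sum of `2 ^ (m / ∏ p ∈ S, p)` over all sets `S` of prime
divisors of `m` different from `3`, reduced by `2` if `m ≡ 2 (mod 4)` and `2` is the only prime
divisor different from `3`. -/
def explicitN (m : ℕ) : ℚ :=
  if primesNotThree m = ∅ then (2 ^ m + 1) / 3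
  else
    (∑ S ∈ (primesNotThree m).powerset, (-1 : ℚ) ^ S.card * 2 ^ (m / ∏ p ∈ S, p)
      - (if (primesNotThree m).card = 1 ∧ m % 4 = 2 then 2 else 0)) / 3

/-! Write `q = 2 ^ k`, and let `k` be coprime to `M`. In the field with `2 ^ M` elements every `x ≠
0, 1` is uniquely `r ^ q / (r ^ q + r)`. If `x` is a root for `β`, the other roots correspond to the
solutions of `t ^ q + t = (r ^ q)⁻¹`, of which there are none or two. So a nonzero `β` has 0, 1 or 3
roots, and weighting each `x` by the inverse size of its fibre gives `(2 ^ M - (-1) ^ M) / 3` values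
`β` without roots (`three_mul_ncard_trinomialRoots_eq_empty`).

For `β` in the subfield of degree `d ∣ m`, having no root in degree `m` means having no root in
degree `d` and `3 ∤ m / d` (`trinomialRoots_eq_empty_iff`). Indeed, after changing `k` modulo `m`, a
nonzero `β` acquires exactly three roots in some finite extension. The `d`-th Frobenius power
permutes them, and it and its `m / d`-th power are both fixed-point-free exactly when it is a
3-cycle and `3 ∤ m / d`.

Sorting `Phi k m` by degree then expresses any degree-weighted sum through `numN`
(`finsum_Phi_eq_sum_divisors`). Weight `1 / d` counts orbits; weight `1` gives a divisor sum that
Möbius inversion solves for `numN`. -/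

/-! ### Roots of the trinomial in a field of degree coprime to `k` -/

/-- The roots of `X ^ (2 ^ k + 1) + X + β`. -/
def trinomialRoots {E : Type*} [Field E] (k : ℕ) (β : E) : Set E :=
  {x | x ^ (2 ^ k + 1) + x + β = 0}

/-- The additive map `t ↦ t ^ (2 ^ k) + t` in characteristic two. -/
def powAddSelf (E : Type*) [Field E] [CharP E 2] (k : ℕ) : E →+ E where
  toFun t := t ^ 2 ^ k + t
  map_zero' := by simp
  map_add' a b := by rw [add_pow_char_pow]; ring

section FiniteField

variable {E : Type*} [Field E] [CharP E 2] {k M : ℕ}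

theorem powAddSelf_apply (t : E) : powAddSelf E k t = t ^ 2 ^ k + t := rfl

theorem isPeriodicPt_frobenius_iff {n : ℕ} {x : E} :
    Function.IsPeriodicPt (frobenius E 2) n x ↔ x ^ 2 ^ n = x := by
  rw [Function.IsPeriodicPt, Function.IsFixedPt, ← coe_iterateFrobenius, iterateFrobenius_def]

theorem pow_two_pow_card_exponent {E : Type*} [Field E] [Finite E] {M : ℕ}
    (hE : Nat.card E = 2 ^ M) (x : E) : x ^ 2 ^ M = x := by
  have := Fintype.ofFinite E
  rw [← hE, Nat.card_eq_fintype_card, FiniteField.pow_card]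

/-- An element fixed by the `k`-th and the `M`-th power of Frobenius is fixed by the `gcd`-th, which
is Frobenius itself. -/
theorem pow_two_pow_eq_self_iff [Finite E] (hE : Nat.card E = 2 ^ M) (hk : k.Coprime M) {x : E} :
    x ^ 2 ^ k = x ↔ x = 0 ∨ x = 1 := by
  constructor
  · intro h
    have h1 := (isPeriodicPt_frobenius_iff.2 h).gcd
      (isPeriodicPt_frobenius_iff.2 (pow_two_pow_card_exponent hE x))
    rw [hk.gcd_eq_one, isPeriodicPt_frobenius_iff] at h1
    have h2 : x * (x - 1) = 0 := by linear_combination h1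
    rcases mul_eq_zero.1 h2 with h | h
    · exact Or.inl h
    · exact Or.inr (sub_eq_zero.1 h)
  · rintro (rfl | rfl) <;> simp

theorem powAddSelf_eq_zero_iff [Finite E] (hE : Nat.card E = 2 ^ M) (hk : k.Coprime M) {t : E} :
    powAddSelf E k t = 0 ↔ t = 0 ∨ t = 1 := by
  rw [powAddSelf_apply, CharTwo.add_eq_zero, pow_two_pow_eq_self_iff hE hk]

theorem powAddSelf_eq_iff [Finite E] (hE : Nat.card E = 2 ^ M) (hk : k.Coprime M) {t s : E} :
    powAddSelf E k t = powAddSelf E k s ↔ t = s ∨ t = s + 1 := by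
  rw [← sub_eq_zero, ← map_sub, powAddSelf_eq_zero_iff hE hk, sub_eq_zero, sub_eq_iff_eq_add,
    add_comm 1 s]

theorem two_mul_card_range_powAddSelf [Finite E] (hE : Nat.card E = 2 ^ M) (hk : k.Coprime M) :
    2 * Nat.card (powAddSelf E k).range = 2 ^ M := by
  rw [← AddSubgroup.index_ker, ← hE, ← AddSubgroup.card_mul_index (powAddSelf E k).ker]
  congr 1
  have : ((powAddSelf E k).ker : Set E) = {0, 1} := by
    ext t; simp [powAddSelf_eq_zero_iff hE hk]
  rw [← SetLike.coe_sort_coe, this, Nat.card_coe_set_eq, Set.ncard_pair zero_ne_one]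

/-- Roots different from `0` and `1` are parametrized by `r ↦ r ^ (2 ^ k) / (r ^ (2 ^ k) + r)`. -/
def rootParam (k : ℕ) (r : E) : E := r ^ 2 ^ k / (r ^ 2 ^ k + r)

theorem pow_add_self_ne_zero [Finite E] (hE : Nat.card E = 2 ^ M) (hk : k.Coprime M) {r : E}
    (h0 : r ≠ 0) (h1 : r ≠ 1) : r ^ 2 ^ k + r ≠ 0 := by
  rw [← powAddSelf_apply, Ne, powAddSelf_eq_zero_iff hE hk]; tauto

/-- Equal parameters force `r / s` to be fixed by the `k`-th Frobenius power, hence to be `1`;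
finiteness gives surjectivity. -/
theorem bijOn_rootParam [Finite E] (hE : Nat.card E = 2 ^ M) (hk : k.Coprime M) :
    Set.BijOn (rootParam (E := E) k) {0, 1}ᶜ {0, 1}ᶜ := by
  have hm : Set.MapsTo (rootParam (E := E) k) {0, 1}ᶜ {0, 1}ᶜ := by
    intro r hr
    simp only [Set.mem_compl_iff, Set.mem_insert_iff, Set.mem_singleton_iff, not_or] at hr ⊢
    have hc := pow_add_self_ne_zero hE hk hr.1 hr.2
    refine ⟨div_ne_zero (pow_ne_zero _ hr.1) hc, fun h => hr.1 ?_⟩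
    rw [rootParam, div_eq_one_iff_eq hc] at h
    simpa using h.symm
  have hi : Set.InjOn (rootParam (E := E) k) {0, 1}ᶜ := by
    intro r hr s hs h
    simp only [Set.mem_compl_iff, Set.mem_insert_iff, Set.mem_singleton_iff, not_or] at hr hs
    have hc := pow_add_self_ne_zero hE hk hr.1 hr.2
    have hc' := pow_add_self_ne_zero hE hk hs.1 hs.2
    rw [rootParam, rootParam, div_eq_div_iff hc hc'] at h
    have h2 : (r / s) ^ 2 ^ k = r / s := by
      rw [div_pow, div_eq_div_iff (pow_ne_zero _ hs.1) hs.1]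
      linear_combination h
    rcases (pow_two_pow_eq_self_iff hE hk).1 h2 with h | h
    · exact absurd h (div_ne_zero hr.1 hs.1)
    · exact (div_eq_one_iff_eq hs.1).1 h
  refine ⟨hm, hi, ?_⟩
  exact (Set.eq_of_subset_of_ncard_le hm.image_subset hi.ncard_image.ge).ge

/-- Put `x = rootParam k r`, `z = y + x` and `c = r ^ q + r`. Subtracting the equation of `x` leaves
`z ^ q * z + z ^ q * x + (x ^ q + 1) * z = 0`. The parameter `r` is chosen so that `c * x` and `c ^
q * (x ^ q + 1)` both equal `r ^ q`, which makes the equation additive in `t = (c * z)⁻¹`. -/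
theorem mem_trinomialRoots_rootParam_iff [Finite E] (hE : Nat.card E = 2 ^ M) (hk : k.Coprime M)
    {r y β : E} (h0 : r ≠ 0) (h1 : r ≠ 1) (hr : rootParam k r ∈ trinomialRoots k β)
    (hy : y ≠ rootParam k r) :
    y ∈ trinomialRoots k β ↔
      powAddSelf E k (((r ^ 2 ^ k + r) * (y + rootParam k r))⁻¹) = (r ^ 2 ^ k)⁻¹ := by
  have hc := pow_add_self_ne_zero hE hk h0 h1
  have hz : y + rootParam k r ≠ 0 := by rwa [Ne, CharTwo.add_eq_zero]
  have hcq : (r ^ 2 ^ k + r) ^ 2 ^ k = (r ^ 2 ^ k) ^ 2 ^ k + r ^ 2 ^ k := add_pow_char_pow ..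
  have hcq0 := pow_ne_zero (2 ^ k) hc
  have ha : r ^ 2 ^ k ≠ 0 := pow_ne_zero _ h0
  have hxq : rootParam k r ^ 2 ^ k = (r ^ 2 ^ k) ^ 2 ^ k / (r ^ 2 ^ k + r) ^ 2 ^ k := by
    rw [rootParam, div_pow]
  have hx : rootParam k r = r ^ 2 ^ k / (r ^ 2 ^ k + r) := rfl
  obtain ⟨z, rfl⟩ : ∃ z, y = z + rootParam k r := ⟨y - rootParam k r, by ring⟩
  have h2 : (2 : E) = 0 := CharTwo.two_eq_zero
  have hzx : z + rootParam k r + rootParam k r = z := by linear_combination rootParam k r * h2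
  rw [hzx] at hz ⊢
  have hzq := pow_ne_zero (2 ^ k) hz
  have hp : (z + rootParam k r) ^ 2 ^ k = z ^ 2 ^ k + rootParam k r ^ 2 ^ k := add_pow_char_pow ..
  simp only [trinomialRoots, Set.mem_ofPred_eq, pow_succ _ (2 ^ k)] at hr ⊢
  rw [powAddSelf_apply, inv_pow, mul_pow, hp]
  generalize rootParam k r = x at *
  generalize x ^ 2 ^ k = xq at *
  generalize z ^ 2 ^ k = zq at *
  generalize (r ^ 2 ^ k + r) ^ 2 ^ k = cq at *
  generalize (r ^ 2 ^ k) ^ 2 ^ k = aq at *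
  generalize hcc : r ^ 2 ^ k + r = c at *
  generalize r ^ 2 ^ k = a at *
  have e1 : (zq + xq) * (z + x) + (z + x) + β = zq * z + zq * x + xq * z + z := by
    linear_combination hr
  rw [e1]
  have hx' : x * c = a := by rw [hx]; field_simp
  have hxq' : (xq + 1) * cq = a := by
    rw [hxq]; field_simp; linear_combination hcq + aq * h2
  have e2 : (cq * zq)⁻¹ + (c * z)⁻¹ = a⁻¹ ↔ a * (c * z) + a * (cq * zq) + cq * zq * (c * z) = 0 := by
    rw [← CharTwo.add_eq_zero]
    constructor
    · intro h
      field_simp at h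
      linear_combination h
    · intro h
      field_simp
      linear_combination h
  rw [e2]
  have e3 : a * (c * z) + a * (cq * zq) + cq * zq * (c * z) =
      c * cq * (zq * z + zq * x + xq * z + z) := by
    linear_combination (-c * z) * hxq' - cq * zq * hx'
  rw [e3]
  simp [hc, hcq0]

/-- The kernel of `powAddSelf` is `{0, 1}`, so one solution `t` brings exactly one more, `t + 1`;
each yields a further root. -/
theorem ncard_trinomialRoots_of_mem_range [Finite E] (hE : Nat.card E = 2 ^ M) (hk : k.Coprime M)
    {r β : E} (h0 : r ≠ 0) (h1 : r ≠ 1) (hr : rootParam k r ∈ trinomialRoots k β)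
    (hu : (r ^ 2 ^ k)⁻¹ ∈ (powAddSelf E k).range) : (trinomialRoots k β).ncard = 3 := by
  obtain ⟨t, ht⟩ := hu
  have hc := pow_add_self_ne_zero hE hk h0 h1
  have hu0 : (r ^ 2 ^ k)⁻¹ ≠ 0 := inv_ne_zero (pow_ne_zero _ h0)
  have htn : t ≠ 0 ∧ t ≠ 1 := by
    rw [← not_or, ← powAddSelf_eq_zero_iff hE hk, ht]; exact hu0
  have ht1 : t + 1 ≠ 0 := by rw [Ne, CharTwo.add_eq_zero]; exact htn.2
  set c := r ^ 2 ^ k + r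
  set x := rootParam k r
  have h2 : (2 : E) = 0 := CharTwo.two_eq_zero
  have hxx : ∀ w, x + w + x = w := fun w => by linear_combination x * h2
  have key : trinomialRoots k β = {x, x + (c * t)⁻¹, x + (c * (t + 1))⁻¹} := by
    ext y
    by_cases hy : y = x
    · simp [hy, hr]
    · rw [mem_trinomialRoots_rootParam_iff hE hk h0 h1 hr hy, ← ht, powAddSelf_eq_iff hE hk]
      have hyx : y + x ≠ 0 := by rwa [Ne, CharTwo.add_eq_zero]
      have aux : ∀ s : E, s ≠ 0 → ((c * (y + x))⁻¹ = s ↔ y = x + (c * s)⁻¹) := by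
        intro s hs
        constructor
        · rintro rfl
          field_simp
          linear_combination - x * h2
        · rintro rfl
          rw [hxx]
          field_simp
      rw [aux t htn.1, aux _ ht1]
      simp [hy]
  rw [key]
  refine Set.ncard_eq_three.2 ⟨_, _, _, ?_, ?_, ?_, rfl⟩
  · simp [hc, htn.1]
  · simp [hc, ht1]
  · intro h
    have := mul_left_cancel₀ hc (inv_injective (add_left_cancel h))
    simp at this

theorem trinomialRoots_eq_singleton_of_notMem_range [Finite E] (hE : Nat.card E = 2 ^ M)
    (hk : k.Coprime M) {r β : E} (h0 : r ≠ 0) (h1 : r ≠ 1) (hr : rootParam k r ∈ trinomialRoots k β)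
    (hu : (r ^ 2 ^ k)⁻¹ ∉ (powAddSelf E k).range) : trinomialRoots k β = {rootParam k r} := by
  ext y
  by_cases hy : y = rootParam k r
  · simp [hy, hr]
  · rw [mem_trinomialRoots_rootParam_iff hE hk h0 h1 hr hy]
    simp only [Set.mem_singleton_iff, hy, iff_false]
    exact fun h => hu ⟨_, h⟩

end FiniteField

/-! ### Counting the `β` without roots -/

/-- Each fibre has total weight 1. This serves both for values of the trinomial and for Galois
orbits. -/
theorem Finset.sum_inv_card_fiber {α β : Type*} [DecidableEq β] (s : Finset α) (f : α → β) :
    ∑ x ∈ s, (1 : ℚ) / (s.filter fun y => f y = f x).card = (s.image f).card := by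
  rw [Finset.card_eq_sum_ones, Nat.cast_sum]
  symm
  refine Finset.sum_image' _ fun x hx => ?_
  have h : ∀ y ∈ s.filter (fun y => f y = f x),
      (1 : ℚ) / (s.filter fun z => f z = f y).card = 1 / (s.filter fun z => f z = f x).card := by
    intro y hy
    rw [(Finset.mem_filter.1 hy).2]
  rw [Finset.sum_congr rfl h, Finset.sum_const, nsmul_eq_mul, mul_one_div_cancel]
  · simp
  · exact Nat.cast_ne_zero.2 (Finset.card_ne_zero_of_mem (Finset.mem_filter.2 ⟨hx, rfl⟩))

section FiniteField

variable {E : Type*} [Field E] [CharP E 2] {k M : ℕ}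

/-- A solution of `t ^ q + t = 1` is fixed by the `2 * k`-th Frobenius power, so for odd `M` it
would be `0` or `1`. For even `M`, `k` is odd and a primitive cube root of unity is a solution, as
`q ≡ 2` modulo 3. -/
theorem one_mem_range_powAddSelf_iff [Finite E] (hE : Nat.card E = 2 ^ M) (hk : k.Coprime M) :
    (1 : E) ∈ (powAddSelf E k).range ↔ Even M := by
  have h2 : (2 : E) = 0 := CharTwo.two_eq_zero
  constructor
  · rintro ⟨t, ht⟩
    by_contra hM
    have ht' : t ^ 2 ^ k = t + 1 := by
      rw [powAddSelf_apply] at ht; linear_combination ht - t * h2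
    have h4 : t ^ 2 ^ (2 * k) = t := by
      rw [two_mul, pow_add 2, pow_mul, ht', add_pow_char_pow, ht', one_pow]
      linear_combination h2
    have hc : (2 * k).Coprime M :=
      Nat.Coprime.mul_left ((Nat.coprime_two_left).2 (Nat.not_even_iff_odd.1 hM)) hk
    rcases (pow_two_pow_eq_self_iff hE hc).1 h4 with rfl | rfl <;> simp [powAddSelf_apply] at ht
  · intro hM
    have hk' : Odd k := Nat.coprime_two_right.1 (hk.coprime_dvd_right hM.two_dvd)
    have hd : 3 ∣ Nat.card Eˣ := by
      rw [Nat.card_units, hE]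
      obtain ⟨j, rfl⟩ := hM.two_dvd
      rw [pow_mul]
      exact (Nat.sub_dvd_pow_sub_pow (2 ^ 2) 1 j).trans (by rw [one_pow])
    have : Fact (Nat.Prime 3) := ⟨Nat.prime_three⟩
    obtain ⟨w, hw⟩ := exists_prime_orderOf_dvd_card' 3 hd
    have hw3 : (w : E) ^ 3 = 1 := by
      rw [← Units.val_pow_eq_pow_val, ← hw, pow_orderOf_eq_one, Units.val_one]
    have hw1 : (w : E) ≠ 1 := by
      intro h
      rw [Units.val_eq_one] at h
      simp [h] at hw
    have hq : (w : E) ^ 2 + w + 1 = 0 := by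
      apply mul_left_cancel₀ (sub_ne_zero.2 hw1)
      linear_combination hw3
    refine ⟨w, ?_⟩
    obtain ⟨j, rfl⟩ := hk'
    have h3 : 2 ^ (2 * j + 1) % 3 = 2 := by
      rw [pow_succ, pow_mul, Nat.mul_mod, Nat.pow_mod]; norm_num
    rw [powAddSelf_apply, ← Nat.div_add_mod (2 ^ (2 * j + 1)) 3, h3, pow_add, pow_mul, hw3, one_pow]
    linear_combination hq - h2

theorem trinomial_ne_zero {x : E} (h0 : x ≠ 0) (h1 : x ≠ 1) : x ^ (2 ^ k + 1) + x ≠ 0 := by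
  intro h
  have h2 : (2 : E) = 0 := CharTwo.two_eq_zero
  have h3 : x * (x + 1) ^ 2 ^ k = 0 := by
    rw [add_pow_char_pow, one_pow]; linear_combination h
  have h4 := eq_zero_of_pow_eq_zero ((mul_eq_zero.1 h3).resolve_left h0)
  exact h1 (CharTwo.add_eq_zero.1 h4)

theorem mem_trinomialRoots_iff {x β : E} : x ∈ trinomialRoots k β ↔ x ^ (2 ^ k + 1) + x = β :=
  CharTwo.add_eq_zero

theorem ne_zero_and_ne_one_of_mem_trinomialRoots {x β : E} (hβ : β ≠ 0)
    (hx : x ∈ trinomialRoots k β) : x ≠ 0 ∧ x ≠ 1 := by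
  rw [mem_trinomialRoots_iff] at hx
  constructor
  · rintro rfl; exact hβ (by simpa using hx.symm)
  · rintro rfl
    have h2 : (2 : E) = 0 := CharTwo.two_eq_zero
    exact hβ (by rw [← hx, one_pow]; linear_combination h2)

theorem exists_rootParam_eq [Finite E] (hE : Nat.card E = 2 ^ M) (hk : k.Coprime M) {x : E}
    (h0 : x ≠ 0) (h1 : x ≠ 1) : ∃ r : E, r ≠ 0 ∧ r ≠ 1 ∧ rootParam k r = x := by
  obtain ⟨r, hr, h⟩ := (bijOn_rootParam (E := E) hE hk).surjOn (a := x) (by simp [h0, h1])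
  exact ⟨r, by simpa [and_assoc] using And.intro hr h⟩

theorem three_mul_ncard_trinomialRoots_eq_empty [Finite E] (hE : Nat.card E = 2 ^ M)
    (hk : k.Coprime M) :
    3 * (({β : E | trinomialRoots k β = ∅}.ncard : ℕ) : ℚ) = 2 ^ M - (-1) ^ M := by
  classical
  have := Fintype.ofFinite E
  have hcE : Fintype.card E = 2 ^ M := by rw [← hE, Nat.card_eq_fintype_card]
  set f : E → E := fun x => x ^ (2 ^ k + 1) + x with hf
  set U : Finset E := {0, 1}ᶜ with hU
  have memU : ∀ x, x ∈ U ↔ x ≠ 0 ∧ x ≠ 1 := by intro x; simp [hU]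
  have hUc : (U.card : ℚ) = 2 ^ M - 2 := by
    have h := Finset.card_compl_add_card ({0, 1} : Finset E)
    rw [hcE, Finset.card_pair zero_ne_one] at h
    rw [eq_sub_iff_add_eq]; exact_mod_cast h
  have hfib : ∀ x ∈ U, ((U.filter fun y => f y = f x : Finset E) : Set E) =
      trinomialRoots k (f x) := by
    intro x hx
    rw [memU] at hx
    have hx0 : f x ≠ 0 := trinomial_ne_zero hx.1 hx.2
    ext y
    rw [mem_trinomialRoots_iff, Finset.mem_coe, Finset.mem_filter, memU]
    exact ⟨fun h => h.2, fun h => ⟨ne_zero_and_ne_one_of_mem_trinomialRoots hx0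
      (mem_trinomialRoots_iff.2 h), h⟩⟩
  have hS : ∑ x ∈ U, (1 : ℚ) / (U.filter fun y => f y = f x).card =
      ∑ r ∈ U, if (r ^ 2 ^ k)⁻¹ ∈ (powAddSelf E k).range then (1 / 3 : ℚ) else 1 := by
    symm
    have hb := bijOn_rootParam (E := E) hE hk
    have hb' : ∀ x, x ∈ U ↔ x ∈ ({0, 1}ᶜ : Set E) := by simp [hU]
    refine Finset.sum_bij (fun r _ => rootParam k r) ?_ ?_ ?_ ?_
    · intro r hr; rw [hb'] at hr ⊢; exact hb.mapsTo hr
    · intro r hr s hs h; rw [hb'] at hr hs; exact hb.injOn hr hs h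
    · intro x hx; rw [hb'] at hx
      obtain ⟨r, hr, h⟩ := hb.surjOn hx
      exact ⟨r, (hb' r).2 hr, h⟩
    · intro r hr
      have hmem : rootParam k r ∈ U := by rw [hb'] at hr ⊢; exact hb.mapsTo hr
      rw [← Set.ncard_coe_finset, hfib _ hmem]
      have hroot : rootParam k r ∈ trinomialRoots k (f (rootParam k r)) :=
        mem_trinomialRoots_iff.2 rfl
      rw [memU] at hr
      split_ifs with h
      · rw [ncard_trinomialRoots_of_mem_range hE hk hr.1 hr.2 hroot h]; norm_num
      · rw [trinomialRoots_eq_singleton_of_notMem_range hE hk hr.1 hr.2 hroot h]; simp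
  -- The map `r ↦ (r ^ q)⁻¹` permutes the elements other than `0` and `1`, so it suffices to count
  -- the range there; parity of `M` enters through whether `1` lies in it.
  have hB : (U.filter fun r => (r ^ 2 ^ k)⁻¹ ∈ (powAddSelf E k).range).card =
      (U.filter fun u => u ∈ (powAddSelf E k).range).card := by
    have hi : Function.Injective fun r : E => (r ^ 2 ^ k)⁻¹ := by
      intro r s h
      have h := inv_injective h
      simp only [← iterateFrobenius_def] at h
      exact (iterateFrobenius E 2 k).injective h
    have hs := Finite.surjective_of_injective hi
    refine Finset.card_bij (fun r _ => (r ^ 2 ^ k)⁻¹) ?_ (fun r _ s _ h => hi h) ?_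
    · intro r hr
      rw [Finset.mem_filter, memU] at hr ⊢
      refine ⟨⟨inv_ne_zero (pow_ne_zero _ hr.1.1), fun h => hr.1.2 (hi ?_)⟩, hr.2⟩
      simpa using h
    · intro u hu
      obtain ⟨r, rfl⟩ := hs u
      refine ⟨r, ?_, rfl⟩
      rw [Finset.mem_filter, memU] at hu ⊢
      refine ⟨⟨?_, ?_⟩, hu.2⟩
      · rintro rfl; simp at hu
      · rintro rfl; simp at hu
  have hR : ((U.filter fun u => u ∈ (powAddSelf E k).range).card : ℚ) +
      (if Even M then 2 else 1) = 2 ^ M / 2 := by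
    have h1 := two_mul_card_range_powAddSelf (E := E) hE hk
    have h2 : Nat.card (powAddSelf E k).range =
        (Finset.univ.filter fun u => u ∈ (powAddSelf E k).range).card := by
      rw [Nat.card_eq_fintype_card, Fintype.card_subtype]
    have h3 := Finset.card_filter_add_card_filter_not (s := Finset.univ.filter fun u =>
      u ∈ (powAddSelf E k).range) (fun u => u ∈ U)
    have h4 : ((Finset.univ.filter fun u => u ∈ (powAddSelf E k).range).filter fun u => u ∈ U) =
        U.filter fun u => u ∈ (powAddSelf E k).range := by ext; simp [and_comm]
    have h5 : ((Finset.univ.filter fun u => u ∈ (powAddSelf E k).range).filter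
        fun u => ¬ u ∈ U).card = if Even M then 2 else 1 := by
      split_ifs with hM
      · rw [← one_mem_range_powAddSelf_iff hE hk] at hM
        rw [← Finset.card_pair (zero_ne_one (α := E))]
        congr 1
        ext u
        simp only [Finset.mem_filter, Finset.mem_univ, true_and, memU, Finset.mem_insert,
          Finset.mem_singleton]
        constructor
        · tauto
        · rintro (rfl | rfl)
          · simp [zero_mem]
          · simp [hM]
      · rw [← one_mem_range_powAddSelf_iff hE hk] at hM
        rw [← Finset.card_singleton (0 : E)]
        congr 1
        ext u
        simp only [Finset.mem_filter, Finset.mem_univ, true_and, memU, Finset.mem_singleton]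
        constructor
        · rintro ⟨h, h'⟩
          by_contra h0
          exact h' ⟨h0, fun h1 => hM (h1 ▸ h)⟩
        · rintro rfl
          simp [zero_mem]
    rw [h4, h5, ← h2] at h3
    have h6 : ((Nat.card (powAddSelf E k).range : ℕ) : ℚ) = 2 ^ M / 2 := by
      rw [eq_div_iff two_ne_zero, mul_comm]; exact_mod_cast h1
    rw [← h6, ← h3]; push_cast; rfl
  -- The extra 1 is the value `β = 0`, attained only at the excluded points `0` and `1`.
  have hI : ({β : E | trinomialRoots k β = ∅}.ncard : ℚ) + ((U.image f).card + 1) = 2 ^ M := by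
    have h0 : (0 : E) ∉ U.image f := by
      rw [Finset.mem_image]
      rintro ⟨x, hx, h⟩
      rw [memU] at hx
      exact trinomial_ne_zero hx.1 hx.2 h
    have hset : {β : E | trinomialRoots k β = ∅} = ((insert 0 (U.image f) : Finset E)ᶜ : Finset E) := by
      ext β
      rw [Set.mem_ofPred_eq, Finset.mem_coe, Finset.mem_compl, Finset.mem_insert, Finset.mem_image,
        Set.eq_empty_iff_forall_notMem]
      simp only [mem_trinomialRoots_iff, not_or, not_exists, not_and]
      constructor
      · intro h
        exact ⟨fun hb => h 0 (by simp [hb]), fun x _ => h x⟩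
      · rintro ⟨hb, h⟩ x hx
        exact h x ((memU x).2 (ne_zero_and_ne_one_of_mem_trinomialRoots hb
          (mem_trinomialRoots_iff.2 hx))) hx
    rw [hset, Set.ncard_coe_finset]
    have := Finset.card_compl_add_card (insert 0 (U.image f))
    rw [hcE, Finset.card_insert_of_notMem h0] at this
    exact_mod_cast this
  have hF : ∑ x ∈ U, (1 : ℚ) / (U.filter fun y => f y = f x).card = (U.image f).card := by
    convert Finset.sum_inv_card_fiber U f
  rw [hF, Finset.sum_ite, Finset.sum_const, Finset.sum_const,
    nsmul_eq_mul, nsmul_eq_mul] at hS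
  have hN := Finset.card_filter_add_card_filter_not (s := U)
    (fun r => (r ^ 2 ^ k)⁻¹ ∈ (powAddSelf E k).range)
  have hN' : ((U.filter fun r => (r ^ 2 ^ k)⁻¹ ∈ (powAddSelf E k).range).card : ℚ) +
    (U.filter fun r => ¬ (r ^ 2 ^ k)⁻¹ ∈ (powAddSelf E k).range).card = U.card := by
    exact_mod_cast hN
  rw [hB] at hS hN'
  rcases Nat.even_or_odd M with hM | hM
  · rw [hM.neg_one_pow]
    simp only [hM, if_true] at hR
    linarith
  · rw [hM.neg_one_pow]
    simp only [Nat.not_even_iff_odd.2 hM, if_false] at hR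
    linarith

end FiniteField

/-! ### An extension containing three roots -/

theorem Polynomial.exists_irreducible_dvd_not_dvd_natDegree {F : Type*} [Field F] {l : ℕ} (p : F[X])
    (hp : ¬ l ∣ p.natDegree) : ∃ g : F[X], Irreducible g ∧ g ∣ p ∧ ¬ l ∣ g.natDegree := by
  induction p using WfDvdMonoid.induction_on_irreducible with
  | zero => simp at hp
  | unit u hu => simp [natDegree_eq_zero_of_isUnit hu] at hp
  | mul a i ha hi ih =>
    by_cases h : l ∣ i.natDegree
    · rw [natDegree_mul hi.ne_zero ha, Nat.dvd_add_right h] at hp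
      obtain ⟨g, hg, hga, hgl⟩ := ih hp
      exact ⟨g, hg, hga.mul_left i, hgl⟩
    · exact ⟨i, hi, dvd_mul_right i a, h⟩

theorem FiniteField.exists_extension_with_root {F : Type} [Field F] [Finite F] {M l : ℕ}
    (hF : Nat.card F = 2 ^ M) (hl : l.Prime) (hM : ¬ l ∣ M) (p : F[X]) (hp : ¬ l ∣ p.natDegree) :
    ∃ (E : Type) (_ : Field E) (_ : Finite E) (f : F →+* E) (N : ℕ),
      Nat.card E = 2 ^ N ∧ M ∣ N ∧ ¬ l ∣ N ∧ ∃ x : E, p.eval₂ f x = 0 := by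
  obtain ⟨g, hg, ⟨h, rfl⟩, hgl⟩ := p.exists_irreducible_dvd_not_dvd_natDegree hp
  have : Fact (Irreducible g) := ⟨hg⟩
  have hfin : Module.Finite F (AdjoinRoot g) := (AdjoinRoot.powerBasis hg.ne_zero).finite
  have hfr : Module.finrank F (AdjoinRoot g) = g.natDegree := by
    rw [(AdjoinRoot.powerBasis hg.ne_zero).finrank, AdjoinRoot.powerBasis_dim]
  refine ⟨AdjoinRoot g, inferInstance, Module.finite_of_finite F, AdjoinRoot.of g,
    M * g.natDegree, ?_, dvd_mul_right _ _, ?_, AdjoinRoot.root g, ?_⟩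
  · rw [Module.natCard_eq_pow_finrank (K := F), hfr, hF, pow_mul]
  · rw [hl.dvd_mul]; tauto
  · rw [eval₂_mul, AdjoinRoot.eval₂_root, zero_mul]

theorem Nat.Prime.not_dvd_two_pow_self_add_one {p : ℕ} (hp : p.Prime) (h3 : 3 < p) :
    ¬ p ∣ 2 ^ p + 1 := by
  have : Fact p.Prime := ⟨hp⟩
  intro h
  rw [← CharP.cast_eq_zero_iff (ZMod p) p] at h
  push_cast at h
  rw [ZMod.pow_card] at h
  have h' : ((3 : ℕ) : ZMod p) = 0 := by push_cast; linear_combination h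
  rw [CharP.cast_eq_zero_iff (ZMod p) p] at h'
  exact absurd (Nat.le_of_dvd (by norm_num) h') (by omega)

/-- The root count needs the exponent coprime to the degree of the field, which an extension might
destroy. With a prime exponent `l`, only extensions of degree prime to `l` are needed: one supplies
a root, since `l ∤ 2 ^ l + 1`, and a second solves the additive equation, of degree `2 ^ l`. -/
theorem exists_extension_ncard_trinomialRoots_eq_three {F : Type} [Field F] [Finite F] [CharP F 2]
    {k m : ℕ} (hm : m ≠ 0) (hF : Nat.card F = 2 ^ m) (hk : k.Coprime m) {β : F} (hβ : β ≠ 0) :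
    ∃ (k' : ℕ) (E : Type) (_ : Field E) (_ : Finite E) (f : F →+* E),
      k' ≡ k [MOD m] ∧ (trinomialRoots k' (f β)).ncard = 3 := by
  -- Dirichlet's theorem; `l > 3` because `2 ^ l + 1 ≡ 3` modulo `l`.
  obtain ⟨l, hl3, hl, hlk⟩ := Nat.forall_exists_prime_gt_and_modEq 3 hm hk
  have hlm : ¬ l ∣ m := by
    rw [← hl.coprime_iff_not_dvd, Nat.Coprime, hlk.gcd_eq]
    exact hk
  have hd1 : (X ^ (2 ^ l + 1) + X + C β : F[X]).natDegree = 2 ^ l + 1 := by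
    have : 0 < 2 ^ l := by positivity
    rw [add_assoc]
    compute_degree!
  obtain ⟨E, _, _, f, N, hE, hmN, hlN, x, hx⟩ :=
    FiniteField.exists_extension_with_root hF hl hlm (X ^ (2 ^ l + 1) + X + C β)
      (by rw [hd1]; exact hl.not_dvd_two_pow_self_add_one hl3)
  have : CharP E 2 := charP_of_injective_ringHom f.injective 2
  have hlN' : l.Coprime N := hl.coprime_iff_not_dvd.2 hlN
  have hx : x ∈ trinomialRoots l (f β) := by simpa [trinomialRoots] using hx
  have hx01 := ne_zero_and_ne_one_of_mem_trinomialRoots ((map_ne_zero f).2 hβ) hx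
  obtain ⟨r, hr0, hr1, rfl⟩ := exists_rootParam_eq hE hlN' hx01.1 hx01.2
  have hd2 : (X ^ (2 ^ l) + X + C (r ^ 2 ^ l)⁻¹ : E[X]).natDegree = 2 ^ l := by
    have : 1 < 2 ^ l := Nat.one_lt_two_pow hl.ne_zero
    rw [add_assoc]
    compute_degree!
    · rw [if_neg (by omega)]; simp
    · omega
  obtain ⟨K, _, _, g, N', hK, hN', hlN'', t, ht⟩ :=
    FiniteField.exists_extension_with_root hE hl hlN (X ^ (2 ^ l) + X + C (r ^ 2 ^ l)⁻¹)
      (by rw [hd2]; intro h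
          have := (Nat.prime_dvd_prime_iff_eq hl Nat.prime_two).1 (hl.dvd_of_dvd_pow h)
          omega)
  have : CharP K 2 := charP_of_injective_ringHom g.injective 2
  refine ⟨l, K, inferInstance, inferInstance, g.comp f, hlk, ?_⟩
  refine ncard_trinomialRoots_of_mem_range (r := g r) hK (hl.coprime_iff_not_dvd.2 hlN'')
    ((map_ne_zero g).2 hr0) (by simpa using g.injective.ne hr1) ?_ ⟨t, ?_⟩
  · have h1 : rootParam l (g r) = g (rootParam l r) := by simp [rootParam]
    rw [mem_trinomialRoots_iff] at hx ⊢
    rw [h1, RingHom.comp_apply, ← hx]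
    simp
  · simp only [eval₂_add, eval₂_pow, eval₂_X, eval₂_C] at ht
    rw [powAddSelf_apply, CharTwo.add_eq_zero.1 ht]
    simp

/-! ### Frobenius acting on the three roots -/

/-- A permutation of three points without fixed points is a 3-cycle. -/
theorem Equiv.Perm.forall_pow_apply_ne_iff_of_card_eq_three {α : Type*} (hα : Nat.card α = 3)
    (g : Equiv.Perm α) (n : ℕ) :
    (∀ x, (g ^ n) x ≠ x) ↔ (∀ x, g x ≠ x) ∧ ¬ 3 ∣ n := by
  have : Finite α := Nat.finite_of_card_ne_zero (by omega)
  have hdec : ∀ h : Equiv.Perm (Fin 3), (∀ x, h x ≠ x) → h ^ 3 = 1 ∧ ∀ x, (h ^ 2) x ≠ x := by decide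
  have e : α ≃ Fin 3 := Finite.equivFinOfCardEq hα
  have key : (∀ x, g x ≠ x) → g ^ 3 = 1 ∧ ∀ x, (g ^ 2) x ≠ x := by
    intro hg
    have h := hdec (e.permCongrHom g) (fun x hx => hg (e.symm x) (by
      simpa [Equiv.permCongrHom, Equiv.eq_symm_apply] using hx))
    rw [← map_pow, ← map_pow, map_eq_one_iff _ (MulEquiv.injective _)] at h
    refine ⟨h.1, fun x hx => h.2 (e x) ?_⟩
    simpa [Equiv.permCongrHom] using hx
  constructor
  · intro h
    have hg : ∀ x, g x ≠ x := fun x hx => h x (by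
      rw [← Equiv.Perm.iterate_eq_pow]; exact Function.iterate_fixed hx n)
    refine ⟨hg, ?_⟩
    rintro ⟨j, rfl⟩
    rw [pow_mul, (key hg).1, one_pow] at h
    obtain ⟨x⟩ : Nonempty α := ⟨e.symm 0⟩
    exact h x rfl
  · rintro ⟨hg, hn⟩ x
    obtain ⟨h3, h2⟩ := key hg
    rw [← Nat.div_add_mod n 3, pow_add, pow_mul, h3, one_pow, one_mul]
    have : n % 3 = 1 ∨ n % 3 = 2 := by omega
    rcases this with h | h <;> rw [h]
    · simpa using hg x
    · exact h2 x

theorem FiniteField.mem_range_of_pow_eq_self {F E : Type*} [Field F] [Finite F] [Field E]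
    (f : F →+* E) {m : ℕ} (hm : m ≠ 0) (hF : Nat.card F = 2 ^ m) {x : E} (hx : x ^ 2 ^ m = x) :
    ∃ y, f y = x := by
  classical
  have := Fintype.ofFinite F
  have hp : (X ^ 2 ^ m - X : E[X]) ≠ 0 := FiniteField.X_pow_card_pow_sub_X_ne_zero E hm one_lt_two
  have hsub : Finset.univ.image f ⊆ (X ^ 2 ^ m - X : E[X]).roots.toFinset := by
    intro z hz
    obtain ⟨y, -, rfl⟩ := Finset.mem_image.1 hz
    rw [Multiset.mem_toFinset, mem_roots hp]
    simp [← map_pow, pow_two_pow_card_exponent hF y]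
  have heq := Finset.eq_of_subset_of_card_le hsub (by
    rw [Finset.card_image_of_injective _ f.injective, Finset.card_univ, ← Nat.card_eq_fintype_card,
      hF]
    refine (Multiset.toFinset_card_le _).trans ((card_roots' _).trans ?_)
    rw [FiniteField.X_pow_card_pow_sub_X_natDegree_eq E hm one_lt_two])
  have hmem : x ∈ Finset.univ.image f := by
    rw [heq, Multiset.mem_toFinset, mem_roots hp]
    simp [hx]
  simpa using hmem

theorem pow_two_pow_eq_of_modEq {F : Type*} [Field F] [CharP F 2] [Finite F] {m k k' : ℕ}
    (hF : Nat.card F = 2 ^ m) (h : k' ≡ k [MOD m]) (x : F) : x ^ 2 ^ k' = x ^ 2 ^ k := by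
  have hx := isPeriodicPt_frobenius_iff.2 (pow_two_pow_card_exponent hF x)
  have hmod : ∀ n, x ^ 2 ^ n = x ^ 2 ^ (n % m) := by
    intro n
    have := hx.iterate_mod_apply n
    rw [← coe_iterateFrobenius, ← coe_iterateFrobenius, iterateFrobenius_def,
      iterateFrobenius_def] at this
    exact this.symm
  rw [hmod k', hmod k, h]

/-- Among the three roots in the extension, those fixed by the `d`-th Frobenius power `g` lie in
degree `d`, and those fixed by `g ^ (m / d)` lie in degree `m`. -/
theorem trinomialRoots_eq_empty_iff {F : Type} [Field F] [Finite F] [CharP F 2] {k m d : ℕ}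
    (hm : m ≠ 0) (hF : Nat.card F = 2 ^ m) (hk : k.Coprime m) (hd : d ∣ m) {β : F}
    (hβ : β ^ 2 ^ d = β) :
    trinomialRoots k β = ∅ ↔ (∀ x ∈ trinomialRoots k β, x ^ 2 ^ d ≠ x) ∧ ¬ 3 ∣ m / d := by
  -- For `β = 0` both sides fail: the root `0` lies in every subfield.
  by_cases hβ0 : β = 0
  · have h0 : (0 : F) ∈ trinomialRoots k β := by simp [trinomialRoots, hβ0]
    constructor
    · intro h; simp [h] at h0
    · rintro ⟨h, -⟩; exact absurd (by simp) (h 0 h0)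
  obtain ⟨k', E, _, _, f, hkk, h3⟩ := exists_extension_ncard_trinomialRoots_eq_three hm hF hk hβ0
  have : CharP E 2 := charP_of_injective_ringHom f.injective 2
  have hroot : ∀ x : F, f x ∈ trinomialRoots k' (f β) ↔ x ∈ trinomialRoots k β := by
    intro x
    rw [mem_trinomialRoots_iff, mem_trinomialRoots_iff, ← map_pow, ← map_add, f.injective.eq_iff,
      pow_succ, pow_two_pow_eq_of_modEq hF hkk, ← pow_succ]
  have hmaps : Set.MapsTo (iterateFrobenius E 2 d) (trinomialRoots k' (f β))
      (trinomialRoots k' (f β)) := by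
    intro x hx
    rw [mem_trinomialRoots_iff] at hx ⊢
    rw [← map_pow, ← map_add, hx, iterateFrobenius_def, ← map_pow, hβ]
  have hbij : Function.Bijective hmaps.restrict :=
    Finite.injective_iff_bijective.1
      (hmaps.restrict_inj.2 (iterateFrobenius E 2 d).injective.injOn)
  let g : Equiv.Perm (trinomialRoots k' (f β)) := Equiv.ofBijective _ hbij
  have hg : ∀ (n : ℕ) (x : trinomialRoots k' (f β)), (((g ^ n) x : _) : E) = x ^ 2 ^ (d * n) := by
    intro n
    induction n with
    | zero => simp
    | succ n ih =>
      intro x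
      have h1 : ((g ((g ^ n) x) : _) : E) = (((g ^ n) x : _) : E) ^ 2 ^ d := iterateFrobenius_def ..
      rw [pow_succ', Equiv.Perm.mul_apply, h1, ih, ← pow_mul, ← pow_add, mul_add_one]
  have key := Equiv.Perm.forall_pow_apply_ne_iff_of_card_eq_three
    ((Nat.card_coe_set_eq _).trans h3) g (m / d)
  have hdm : d * (m / d) = m := Nat.mul_div_cancel' hd
  have e1 : (∀ x, (g ^ (m / d)) x ≠ x) ↔ trinomialRoots k β = ∅ := by
    rw [Set.eq_empty_iff_forall_notMem]
    simp only [Ne, Subtype.ext_iff, hg, hdm, Subtype.forall]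
    constructor
    · intro h x hx
      refine h (f x) ((hroot x).2 hx) ?_
      rw [← map_pow, pow_two_pow_card_exponent hF]
    · intro h x hx hxm
      obtain ⟨y, rfl⟩ := FiniteField.mem_range_of_pow_eq_self f hm hF hxm
      exact h y ((hroot y).1 hx)
  have e2 : (∀ x, g x ≠ x) ↔ ∀ x ∈ trinomialRoots k β, x ^ 2 ^ d ≠ x := by
    have hg1 : ∀ x, ((g x : _) : E) = x ^ 2 ^ d := fun x => by simpa using hg 1 x
    simp only [Ne, Subtype.ext_iff, hg1, Subtype.forall]
    constructor
    · intro h x hx hxd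
      refine h (f x) ((hroot x).2 hx) ?_
      rw [← map_pow, hxd]
    · intro h x hx hxd
      have hxm : x ^ 2 ^ m = x := by
        rw [← isPeriodicPt_frobenius_iff] at hxd ⊢
        exact hxd.trans_dvd hd
      obtain ⟨y, rfl⟩ := FiniteField.mem_range_of_pow_eq_self f hm hF hxm
      refine h y ((hroot y).1 hx) (f.injective ?_)
      rw [map_pow, hxd]
  rw [← e1, ← e2, key]

/-! ### Sorting `Phi` by degree -/

theorem Phi_eq (k m : ℕ) : Phi k m = {β | trinomialRoots k β = ∅} := by
  ext β
  simp [Phi, trinomialRoots, Set.eq_empty_iff_forall_notMem]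

theorem minimalPeriod_frobenius_dvd_iff {E : Type*} [Field E] [CharP E 2] {n : ℕ} {x : E} :
    Function.minimalPeriod (frobenius E 2) x ∣ n ↔ x ^ 2 ^ n = x := by
  rw [← Function.isPeriodicPt_iff_minimalPeriod_dvd, isPeriodicPt_frobenius_iff]

theorem minimalPeriod_frobenius_map {E K : Type*} [Field E] [CharP E 2] [Field K] [CharP K 2]
    (f : E →+* K) (x : E) :
    Function.minimalPeriod (frobenius K 2) (f x) = Function.minimalPeriod (frobenius E 2) x := by
  refine Nat.dvd_right_iff_eq.1 fun n => ?_
  rw [minimalPeriod_frobenius_dvd_iff, minimalPeriod_frobenius_dvd_iff, ← map_pow,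
    f.injective.eq_iff]

theorem GaloisField.minimalPeriod_frobenius_dvd {m : ℕ} (hm : m ≠ 0) (β : GaloisField 2 m) :
    Function.minimalPeriod (frobenius (GaloisField 2 m) 2) β ∣ m :=
  minimalPeriod_frobenius_dvd_iff.2 (pow_two_pow_card_exponent (GaloisField.card 2 m hm) β)

theorem GaloisField.nonempty_ringHom_of_dvd {d m : ℕ} (hm : m ≠ 0) (hd : d ∣ m) :
    Nonempty (GaloisField 2 d →+* GaloisField 2 m) := by
  have h : Module.finrank (ZMod 2) (GaloisField 2 d) ∣ Module.finrank (ZMod 2) (GaloisField 2 m) := by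
    rwa [GaloisField.finrank 2 hm, GaloisField.finrank 2 (ne_zero_of_dvd_ne_zero hm hd)]
  exact (FiniteField.nonempty_algHom_of_finrank_dvd h).map fun f => f.toRingHom

/-- The Frobenius period of `β` is the degree of the smallest subfield containing it. -/
theorem numN_eq {m : ℕ} (hm : m ≠ 0) (k : ℕ) :
    numN k m = {β ∈ Phi k m |
      Function.minimalPeriod (frobenius (GaloisField 2 m) 2) β = m}.ncard := by
  unfold numN
  congr 1
  ext β
  refine and_congr_right fun _ => ?_
  constructor
  · intro h
    by_contra hne
    have hdvd := GaloisField.minimalPeriod_frobenius_dvd hm β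
    have hlt := lt_of_le_of_ne (Nat.le_of_dvd (Nat.pos_of_ne_zero hm) hdvd) hne
    set d := Function.minimalPeriod (frobenius (GaloisField 2 m) 2) β
    have hd0 : d ≠ 0 := ne_zero_of_dvd_ne_zero hm hdvd
    obtain ⟨f⟩ := GaloisField.nonempty_ringHom_of_dvd hm hdvd
    refine h d hdvd hlt f.fieldRange ?_ ?_
    · rw [← GaloisField.card 2 d hd0]
      exact (Nat.card_congr (RingHom.rangeRestrictFieldEquiv f).toEquiv).symm
    · rw [RingHom.mem_fieldRange]
      exact FiniteField.mem_range_of_pow_eq_self f hd0 (GaloisField.card 2 d hd0)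
        (minimalPeriod_frobenius_dvd_iff.1 dvd_rfl)
  · intro h m' _ hlt K hK hβ
    have h1 := pow_two_pow_card_exponent hK ⟨β, hβ⟩
    have h2 : β ^ 2 ^ m' = β := congrArg Subtype.val h1
    rw [← minimalPeriod_frobenius_dvd_iff, h] at h2
    have h0 : m' ≠ 0 := by
      rintro rfl
      rw [pow_zero, Nat.card_eq_one_iff_unique] at hK
      exact not_subsingleton K hK.1
    exact absurd (Nat.le_of_dvd (Nat.pos_of_ne_zero h0) h2) (by omega)

theorem ncard_Phi_minimalPeriod_eq {k m d : ℕ} (hm : m ≠ 0) (hk : k.Coprime m) (hd : d ∣ m) :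
    {β ∈ Phi k m | Function.minimalPeriod (frobenius (GaloisField 2 m) 2) β = d}.ncard =
      if 3 ∣ m / d then 0 else numN k d := by
  have hd0 : d ≠ 0 := ne_zero_of_dvd_ne_zero hm hd
  have hcm := GaloisField.card 2 m hm
  have hiff : ∀ β : GaloisField 2 m, Function.minimalPeriod (frobenius (GaloisField 2 m) 2) β = d →
      (β ∈ Phi k m ↔ (∀ x ∈ trinomialRoots k β, x ^ 2 ^ d ≠ x) ∧ ¬ 3 ∣ m / d) := by
    intro β hβ
    rw [Phi_eq, Set.mem_ofPred_eq]
    exact trinomialRoots_eq_empty_iff hm hcm hk hd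
      (minimalPeriod_frobenius_dvd_iff.1 (dvd_of_eq hβ))
  split_ifs with h3
  · rw [Set.ncard_eq_zero]
    ext β
    simp only [Set.mem_ofPred_eq, Set.mem_empty_iff_false, iff_false, not_and]
    intro h1 h2
    exact ((hiff β h2).1 h1).2 h3
  · obtain ⟨f⟩ := GaloisField.nonempty_ringHom_of_dvd hm hd
    rw [numN_eq hd0, ← Set.ncard_image_of_injective _ f.injective]
    congr 1
    have hroot : ∀ x β : GaloisField 2 d,
        f x ∈ trinomialRoots k (f β) ↔ x ∈ trinomialRoots k β := by
      intro x β
      rw [mem_trinomialRoots_iff, mem_trinomialRoots_iff, ← map_pow, ← map_add,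
        f.injective.eq_iff]
    have hcd := GaloisField.card 2 d hd0
    have hf : ∀ β : GaloisField 2 d, β ∈ Phi k d ↔ ∀ x ∈ trinomialRoots k (f β), x ^ 2 ^ d ≠ x := by
      intro β
      rw [Phi_eq, Set.mem_ofPred_eq, Set.eq_empty_iff_forall_notMem]
      constructor
      · intro h x hx hxd
        obtain ⟨y, rfl⟩ := FiniteField.mem_range_of_pow_eq_self f hd0 hcd hxd
        exact h y ((hroot _ _).1 hx)
      · intro h x hx
        refine h (f x) ((hroot _ _).2 hx) ?_
        rw [← map_pow, pow_two_pow_card_exponent hcd]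
    ext β
    constructor
    · rintro ⟨h1, h2⟩
      obtain ⟨γ, rfl⟩ := FiniteField.mem_range_of_pow_eq_self f hd0 hcd
        (minimalPeriod_frobenius_dvd_iff.1 (dvd_of_eq h2))
      refine ⟨γ, ⟨(hf γ).2 ((hiff _ h2).1 h1).1, ?_⟩, rfl⟩
      rw [← minimalPeriod_frobenius_map f, h2]
    · rintro ⟨γ, ⟨h1, h2⟩, rfl⟩
      rw [← minimalPeriod_frobenius_map f] at h2
      exact ⟨(hiff _ h2).2 ⟨(hf γ).1 h1, h3⟩, h2⟩

theorem finsum_Phi_eq_sum_divisors {k m : ℕ} (hm : m ≠ 0) (hk : k.Coprime m) (w : ℕ → ℚ) :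
    ∑ β ∈ (Phi k m).toFinite.toFinset, w (Function.minimalPeriod (frobenius (GaloisField 2 m) 2) β) =
      ∑ d ∈ m.divisors.filter (fun d => ¬ 3 ∣ m / d), (numN k d : ℚ) * w d := by
  rw [Finset.sum_filter, ← Finset.sum_fiberwise_of_maps_to (t := m.divisors)
    (g := fun β => Function.minimalPeriod (frobenius (GaloisField 2 m) 2) β)
    (fun β _ => Nat.mem_divisors.2 ⟨GaloisField.minimalPeriod_frobenius_dvd hm β, hm⟩)]
  refine Finset.sum_congr rfl fun d hd => ?_
  rw [Finset.sum_congr rfl fun β hβ => by rw [(Finset.mem_filter.1 hβ).2], Finset.sum_const,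
    nsmul_eq_mul, ← Set.ncard_coe_finset]
  have h := ncard_Phi_minimalPeriod_eq hm hk (Nat.dvd_of_mem_divisors hd)
  have hset : ((((Phi k m).toFinite.toFinset.filter fun β =>
      Function.minimalPeriod (frobenius (GaloisField 2 m) 2) β = d : Finset _)) : Set _) =
      {β ∈ Phi k m | Function.minimalPeriod (frobenius (GaloisField 2 m) 2) β = d} := by
    ext β; simp
  rw [hset, h]
  split_ifs <;> simp

theorem sum_numN_eq {k m : ℕ} (hm : m ≠ 0) (hk : k.Coprime m) :
    ∑ d ∈ m.divisors.filter (fun d => ¬ 3 ∣ m / d), (numN k d : ℚ) = (2 ^ m - (-1) ^ m) / 3 := by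
  have h := finsum_Phi_eq_sum_divisors hm hk fun _ => 1
  have h2 := three_mul_ncard_trinomialRoots_eq_empty (GaloisField.card 2 m hm) hk
  rw [← Phi_eq] at h2
  simp only [mul_one, Finset.sum_const, nsmul_eq_mul] at h
  rw [← h, ← Set.ncard_eq_toFinset_card, ← h2]
  ring

/-! ### Galois orbits -/

theorem galOrbit_eq_image {m : ℕ} (hm : m ≠ 0) (β : GaloisField 2 m) :
    galOrbit β = (fun i => (frobenius (GaloisField 2 m) 2)^[i] β) ''
      Set.Iio (Function.minimalPeriod (frobenius (GaloisField 2 m) 2) β) := by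
  have hdvd := GaloisField.minimalPeriod_frobenius_dvd hm β
  have hm' := Nat.pos_of_ne_zero hm
  have hit : ∀ i, (frobenius (GaloisField 2 m) 2)^[i] β = β ^ 2 ^ i := by
    intro i; rw [← coe_iterateFrobenius, iterateFrobenius_def]
  ext γ
  simp only [galOrbit, Set.mem_ofPred_eq, Set.mem_image, Set.mem_Iio, ← hit]
  constructor
  · rintro ⟨i, -, rfl⟩
    exact ⟨_, Nat.mod_lt _ (Nat.pos_of_dvd_of_pos hdvd hm'), Function.iterate_mod_minimalPeriod_eq⟩
  · rintro ⟨i, hi, rfl⟩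
    exact ⟨i, hi.trans_le (Nat.le_of_dvd hm' hdvd), rfl⟩

theorem ncard_galOrbit {m : ℕ} (hm : m ≠ 0) (β : GaloisField 2 m) :
    (galOrbit β).ncard = Function.minimalPeriod (frobenius (GaloisField 2 m) 2) β := by
  rw [galOrbit_eq_image hm, Function.iterate_injOn_Iio_minimalPeriod.ncard_image]
  simp

theorem galOrbit_eq_galOrbit_iff {m : ℕ} (hm : m ≠ 0) {β γ : GaloisField 2 m} :
    galOrbit γ = galOrbit β ↔ γ ∈ galOrbit β := by
  rw [galOrbit_eq_orbit hm, galOrbit_eq_orbit hm, MulAction.orbit_eq_iff]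

theorem pow_two_pow_mem_Phi {k m : ℕ} {β : GaloisField 2 m} (hβ : β ∈ Phi k m) (i : ℕ) :
    β ^ 2 ^ i ∈ Phi k m := by
  rw [Phi_eq, Set.mem_ofPred_eq, Set.eq_empty_iff_forall_notMem] at hβ ⊢
  intro x hx
  obtain ⟨y, rfl⟩ := Finite.surjective_of_injective (iterateFrobenius (GaloisField 2 m) 2 i).injective x
  refine hβ y ?_
  rw [mem_trinomialRoots_iff] at hx ⊢
  rwa [← map_pow, ← map_add, ← iterateFrobenius_def, RingHom.injective _ |>.eq_iff] at hx

theorem numB_eq {k m : ℕ} (hm : m ≠ 0) (hk : k.Coprime m) :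
    (numB k m : ℚ) = ∑ d ∈ m.divisors.filter (fun d => ¬ 3 ∣ m / d), (numN k d : ℚ) / (d : ℚ) := by
  classical
  rw [Finset.sum_congr rfl fun d _ => div_eq_mul_one_div (numN k d : ℚ) (d : ℚ),
    ← finsum_Phi_eq_sum_divisors hm hk fun d => 1 / (d : ℚ)]
  have h1 : orbitSet k m = ((Phi k m).toFinite.toFinset.image galOrbit : Finset _) := by
    ext O
    simp [orbitSet, eq_comm]
  rw [numB, h1, Set.ncard_coe_finset, ← Finset.sum_inv_card_fiber]
  refine Finset.sum_congr rfl fun β hβ => ?_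
  rw [← ncard_galOrbit hm, ← Set.ncard_coe_finset]
  congr 3
  ext γ
  rw [Finset.mem_coe, Finset.mem_filter, galOrbit_eq_galOrbit_iff hm, Set.Finite.mem_toFinset]
  refine ⟨fun h => h.2, fun h => ⟨?_, h⟩⟩
  obtain ⟨i, -, rfl⟩ := h
  exact pow_two_pow_mem_Phi ((Set.Finite.mem_toFinset _).1 hβ) i

/-! ### Möbius inversion and the explicit formula -/

theorem ArithmeticFunction.sum_divisors_moebius_mul {n : ℕ} (hn : n ≠ 0) (h : ℕ → ℚ) :
    ∑ d ∈ n.divisors, (ArithmeticFunction.moebius d : ℚ) * h d =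
      ∑ S ∈ n.primeFactors.powerset, (-1 : ℚ) ^ S.card * h (∏ p ∈ S, p) := by
  have h1 : ∑ d ∈ n.divisors, (ArithmeticFunction.moebius d : ℚ) * h d =
      ∑ d ∈ n.divisors with Squarefree d, (ArithmeticFunction.moebius d : ℚ) * h d := by
    rw [Finset.sum_filter]
    refine Finset.sum_congr rfl fun d _ => ?_
    split_ifs with hd
    · rfl
    · rw [ArithmeticFunction.moebius_eq_zero_of_not_squarefree hd, Int.cast_zero, zero_mul]
  have h2 : (UniqueFactorizationMonoid.normalizedFactors n).toFinset = n.primeFactors := by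
    rw [Nat.factors_eq]; rfl
  rw [h1, Nat.sum_divisors_filter_squarefree hn, h2]
  refine Finset.sum_congr rfl fun S hS => ?_
  rw [Finset.prod_val]
  rw [Finset.mem_powerset] at hS
  congr 1
  rw [show S.prod id = ∏ p ∈ S, p from rfl,
    ArithmeticFunction.isMultiplicative_moebius.map_prod_of_subset_primeFactors n S hS,
    Finset.prod_congr rfl fun p hp =>
      ArithmeticFunction.moebius_apply_prime (Nat.prime_of_mem_primeFactors (hS hp)),
    Finset.prod_const]
  push_cast
  rfl

theorem Finset.sum_powerset_neg_one_pow_card_rat {α : Type*} [DecidableEq α] (s : Finset α) :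
    ∑ S ∈ s.powerset, (-1 : ℚ) ^ S.card = if s = ∅ then 1 else 0 := by
  exact_mod_cast Finset.sum_powerset_neg_one_pow_card (x := s)

/-- This is the source of the correction `ε`. For odd `n` all exponents are odd and the sum cancels.
-/
theorem sum_powerset_neg_one_pow_div_prod {n : ℕ} (hn : n ≠ 0) (hP : primesNotThree n ≠ ∅) :
    ∑ S ∈ (primesNotThree n).powerset, (-1 : ℚ) ^ S.card * (-1) ^ (n / ∏ p ∈ S, p) =
      if (primesNotThree n).card = 1 ∧ n % 4 = 2 then 2 else 0 := by
  have hsub : primesNotThree n ⊆ n.primeFactors := Finset.erase_subset _ _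
  have hdvd : ∀ S ⊆ primesNotThree n, ∏ p ∈ S, p ∣ n := fun S hS =>
    (Finset.prod_dvd_prod_of_subset _ _ _ (hS.trans hsub)).trans (Nat.prod_primeFactors_dvd n)
  rcases Nat.even_or_odd n with he | ho
  · have h2 : 2 ∈ primesNotThree n := by
      simp [primesNotThree, hn, he.two_dvd, Nat.prime_two]
    set P := (primesNotThree n).erase 2 with hPdef
    have hins : primesNotThree n = insert 2 P := (Finset.insert_erase h2).symm
    have h2P : 2 ∉ P := Finset.notMem_erase _ _
    have hcard : (primesNotThree n).card = 1 ↔ P = ∅ := by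
      rw [hins, Finset.card_insert_of_notMem h2P, ← Finset.card_eq_zero]; omega
    -- For even `n`, pair `S` with `insert 2 S`: the first exponent is even, the second is odd
    -- exactly when `n % 4 = 2`. The remaining alternating sum over `P` vanishes unless `P` is
    -- empty.
    have key : ∀ S ∈ P.powerset, (-1 : ℚ) ^ S.card * (-1) ^ (n / ∏ p ∈ S, p) +
        (-1 : ℚ) ^ (insert 2 S).card * (-1) ^ (n / ∏ p ∈ insert 2 S, p) =
          (-1 : ℚ) ^ S.card * if n % 4 = 2 then 2 else 0 := by
      intro S hS
      rw [Finset.mem_powerset] at hS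
      have h2S : 2 ∉ S := fun h => h2P (hS h)
      have hodd : Odd (∏ p ∈ S, p) := by
        rw [← Nat.coprime_two_left]
        refine Nat.Coprime.prod_right fun p hp => ?_
        rw [Nat.coprime_primes Nat.prime_two
          (Nat.prime_of_mem_primeFactors (hsub (Finset.mem_of_mem_erase (hS hp))))]
        rintro rfl
        exact h2S hp
      have hd : 2 * ∏ p ∈ S, p ∣ n := by
        have := hdvd (insert 2 S) (by rw [hins]; exact Finset.insert_subset_insert _ hS)
        rwa [Finset.prod_insert h2S] at this
      rw [Finset.card_insert_of_notMem h2S, Finset.prod_insert h2S]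
      obtain ⟨c, hc⟩ := hd
      have hpos : 0 < ∏ p ∈ S, p := hodd.pos
      generalize ∏ p ∈ S, p = a at *
      have e1 : n / a = 2 * c := Nat.div_eq_of_eq_mul_left hpos (by rw [hc]; ring)
      have e2 : n / (2 * a) = c := Nat.div_eq_of_eq_mul_left (by omega) (by rw [hc]; ring)
      rw [e1, e2, (even_two_mul c).neg_one_pow]
      obtain ⟨b, rfl⟩ := hodd
      rcases Nat.even_or_odd' c with ⟨j, rfl | rfl⟩
      · have : n % 4 = 0 := by
          rw [hc, show 2 * (2 * b + 1) * (2 * j) = 4 * ((2 * b + 1) * j) by ring]; omega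
        rw [(even_two_mul j).neg_one_pow, this]
        norm_num
        ring
      · have : n % 4 = 2 := by
          rw [hc, show 2 * (2 * b + 1) * (2 * j + 1) = 4 * (2 * b * j + b + j) + 2 by ring]; omega
        rw [(odd_two_mul_add_one j).neg_one_pow, this]
        norm_num
        ring
    simp only [hcard]
    rw [hins, Finset.sum_powerset_insert h2P, ← Finset.sum_add_distrib,
      Finset.sum_congr rfl key, ← Finset.sum_mul, Finset.sum_powerset_neg_one_pow_card_rat]
    by_cases hPe : P = ∅ <;> by_cases h4 : n % 4 = 2 <;> simp [hPe, h4]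
  · have key : ∀ S ∈ (primesNotThree n).powerset,
        (-1 : ℚ) ^ S.card * (-1) ^ (n / ∏ p ∈ S, p) = (-1 : ℚ) ^ S.card * (-1) := by
      intro S hS
      rw [(ho.of_dvd_nat (Nat.div_dvd_of_dvd (hdvd S (Finset.mem_powerset.1 hS)))).neg_one_pow]
    rw [Finset.sum_congr rfl key, ← Finset.sum_mul, Finset.sum_powerset_neg_one_pow_card_rat,
      if_neg hP, if_neg, zero_mul]
    rintro ⟨-, h⟩
    rw [Nat.odd_iff] at ho
    omega

/-- With `n = 3 ^ a * b` and `3 ∤ b`, the condition `3 ∤ n / d` singles out `d = 3 ^ a * i` with `i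
∣ b`. The sum is thus a full divisor sum over `b`, and inversion involves only primes other than 3.
-/
theorem eq_explicitN_of_sum_eq {m : ℕ} (hm : m ≠ 0) (N : ℕ → ℚ)
    (h : ∀ n, n ∣ m → ∑ d ∈ n.divisors.filter (fun d => ¬ 3 ∣ n / d), N d =
      (2 ^ n - (-1) ^ n) / 3) {n : ℕ} (hn : n ∣ m) : N n = explicitN n := by
  have hn0 : n ≠ 0 := ne_zero_of_dvd_ne_zero hm hn
  obtain ⟨a, b, hb, hnab⟩ := Nat.exists_eq_pow_mul_and_not_dvd hn0 3 (by norm_num)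
  have hb0 : b ≠ 0 := by rintro rfl; simp at hb
  have h3a : 0 < 3 ^ a := by positivity
  have hcop : ∀ {j}, j ∣ b → ¬ 3 ∣ j := fun hj h3 => hb (h3.trans hj)
  have hP : primesNotThree n = b.primeFactors := by
    ext p
    simp only [primesNotThree, Finset.mem_erase, Nat.mem_primeFactors, hnab]
    constructor
    · rintro ⟨hp3, hp, hd, -⟩
      refine ⟨hp, (hp.dvd_mul.1 hd).resolve_left fun h => hp3 ?_, hb0⟩
      exact (Nat.prime_dvd_prime_iff_eq hp Nat.prime_three).1 (hp.dvd_of_dvd_pow h)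
    · rintro ⟨hp, hd, -⟩
      refine ⟨?_, hp, hd.mul_left _, hnab ▸ hn0⟩
      rintro rfl
      exact hb hd
  have hsum : ∀ j > 0, j ∈ {j | j ∣ b} → ∑ i ∈ j.divisors, N (3 ^ a * i) =
      (2 ^ (3 ^ a * j) - (-1) ^ (3 ^ a * j)) / 3 := by
    intro j hj hjb
    rw [← h (3 ^ a * j) ((mul_dvd_mul_left _ hjb).trans (hnab ▸ hn))]
    refine Finset.sum_bij (fun i _ => 3 ^ a * i) ?_ ?_ ?_ fun _ _ => rfl
    · intro i hi
      have hij := Nat.dvd_of_mem_divisors hi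
      rw [Finset.mem_filter, Nat.mem_divisors, Nat.mul_div_mul_left _ _ h3a]
      exact ⟨⟨mul_dvd_mul_left _ hij, by positivity⟩,
        hcop ((Nat.div_dvd_of_dvd hij).trans hjb)⟩
    · intro i _ i' _ hii
      exact Nat.eq_of_mul_eq_mul_left h3a hii
    · intro d hd
      rw [Finset.mem_filter, Nat.mem_divisors] at hd
      obtain ⟨⟨⟨e, he⟩, -⟩, h3⟩ := hd
      have hd0 : 0 < d := Nat.pos_of_ne_zero (by rintro rfl; simp at he; omega)
      rw [he, Nat.mul_div_cancel_left _ hd0] at h3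
      have h3d : 3 ^ a ∣ d := by
        refine Nat.Coprime.dvd_of_dvd_mul_right (k := 3 ^ a) (n := e) ?_ (he ▸ dvd_mul_right _ _)
        exact Nat.Coprime.pow_left a ((Nat.Prime.coprime_iff_not_dvd Nat.prime_three).2 h3)
      obtain ⟨i, rfl⟩ := h3d
      refine ⟨i, Nat.mem_divisors.2 ⟨⟨e, ?_⟩, hj.ne'⟩, rfl⟩
      apply Nat.eq_of_mul_eq_mul_left h3a
      rw [he, mul_assoc]
  have hmoeb := (ArithmeticFunction.sum_eq_iff_sum_mul_moebius_eq_on {j | j ∣ b}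
    (fun _ _ h1 h2 => h1.trans h2)).1 hsum b (Nat.pos_of_ne_zero hb0) dvd_rfl
  rw [Nat.sum_divisorsAntidiagonal (fun x y => (ArithmeticFunction.moebius x : ℚ) *
    ((2 ^ (3 ^ a * y) - (-1) ^ (3 ^ a * y)) / 3)), ArithmeticFunction.sum_divisors_moebius_mul hb0
    (fun x => (2 ^ (3 ^ a * (b / x)) - (-1) ^ (3 ^ a * (b / x))) / 3), ← hP, ← hnab] at hmoeb
  rw [← hmoeb, explicitN]
  split_ifs with h1 h2
  · have hb1 : b = 1 := by
      rw [hP, Nat.primeFactors_eq_empty] at h1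
      exact h1.resolve_left hb0
    have hodd : Odd n := by rw [hnab, hb1, mul_one]; exact Odd.pow (by decide)
    have hn3 : 3 ^ a = n := by rw [hnab, hb1, mul_one]
    rw [h1]
    simp [hb1, hn3, hodd.neg_one_pow]
  all_goals
    have key := sum_powerset_neg_one_pow_div_prod hn0 h1
    rw [← sub_eq_zero] at key
    have hterm : ∀ S ∈ (primesNotThree n).powerset,
        (-1 : ℚ) ^ S.card * ((2 ^ (3 ^ a * (b / ∏ p ∈ S, p)) - (-1) ^ (3 ^ a * (b / ∏ p ∈ S, p))) / 3)
          = ((-1 : ℚ) ^ S.card * 2 ^ (n / ∏ p ∈ S, p) -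
            (-1 : ℚ) ^ S.card * (-1) ^ (n / ∏ p ∈ S, p)) / 3 := by
      intro S hS
      rw [Finset.mem_powerset, hP] at hS
      have hd : ∏ p ∈ S, p ∣ b :=
        (Finset.prod_dvd_prod_of_subset _ _ _ hS).trans (Nat.prod_primeFactors_dvd b)
      rw [← Nat.mul_div_assoc _ hd, ← hnab]
      ring
    rw [Finset.sum_congr rfl hterm, ← Finset.sum_div, Finset.sum_sub_distrib]
  · rw [if_pos h2, sub_eq_zero] at key
    rw [key]
  · rw [if_neg h2, sub_eq_zero] at key
    rw [key]

theorem mainTheorem7 (k m : ℕ) (hk : 0 < k) (hm : 0 < m) (hkm : Nat.Coprime k m) :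
    (numB k m : ℚ) = ∑ m' ∈ m.divisors.filter (fun m' => ¬ 3 ∣ m / m'), (numN k m' : ℚ) / (m' : ℚ) ∧
    ∀ m' : ℕ, m' ∣ m → (numN k m' : ℚ) = explicitN m' :=
  ⟨numB_eq hm.ne' hkm, fun _ hm' => eq_explicitN_of_sum_eq hm.ne' (fun n => (numN k n : ℚ))
    (fun _ hn => sum_numN_eq (ne_zero_of_dvd_ne_zero hm.ne' hn) (hkm.coprime_dvd_right hn)) hm'⟩
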